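/- Let $k$ be a field with algebraic closure $\bar k$, and let $\ell$ be a prime number different from the characteristic of $k$. Let $n\ge 0$ and let $$E_0\xrightarrow{\ \phi_0\ }E_1\xrightarrow{\ \phi_1\ }\cdots\xrightarrow{\ \phi_{n-1}\ }E_n$$ be an $\ell$-isogeny chain of length $n$ over $k$, that is, a sequence of elliptic curves $E_0,\dots,E_n$ over $k$ and of isogenies $\phi_i:E_i\to E_{i+1}$ over $k$ ($0\le i<n$), each of degree $\ell$. The chain is said to be without backtracking if $\ker(\phi_{i+1}\circ\phi_i)\ne E_i[\ell]$ for every $i$ with $0\le i\le n-2$, where $E_i[\ell]=\{P\in E_i(\bar k) : \ell P=O\}$ and kernels are taken on $\bar k$-points. Then the kernel of the composite isogeny $\phi_{n-1}\circ\cdots\circ\phi_0$ (the identity of $E_0$ if $n=0$), a subgroup of $E_0(\bar k)$, is cyclic if and only if the chain is without backtracking. -/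

import Mathlib

open Polynomial

universe u

namespace EllipticIsogeny

open WeierstrassCurve
open scoped Polynomial.Bivariate

noncomputable instance decEqAlgebraicClosure (k : Type u) [Field k] :
    DecidableEq (AlgebraicClosure k) :=
  Classical.decEq _

/-- The group `E(k̄)` of geometric points of a Weierstrass curve `E` over a field `k`. -/
abbrev GeomPoint {k : Type u} [Field k] (E : WeierstrassCurve k) : Type u :=
  (E.baseChange (AlgebraicClosure k)).toAffine.Point

/-- The function in `k(E)` defined by a polynomial in the affine coordinates `x` and `y`. -/
noncomputable def polyFun {k : Type u} [Field k] (E : WeierstrassCurve k) (a : k[X][Y]) :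
    E.toAffine.FunctionField :=
  algebraMap E.toAffine.CoordinateRing E.toAffine.FunctionField
    (Affine.CoordinateRing.mk E.toAffine a)

/-- The coordinate function `x` in `k(E)`. -/
noncomputable def xFun {k : Type u} [Field k] (E : WeierstrassCurve k) :
    E.toAffine.FunctionField :=
  polyFun E (C X)

/-- The coordinate function `y` in `k(E)`. -/
noncomputable def yFun {k : Type u} [Field k] (E : WeierstrassCurve k) :
    E.toAffine.FunctionField :=
  polyFun E Y

/-- An isogeny `φ : E → E'` of elliptic curves over a field `k`: a nonconstant homomorphism given
by rational functions over `k`. It consists of the pullback `φ^* : k(E') → k(E)` of functions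
and of the induced homomorphism `E(k̄) → E'(k̄)`. These are tied together as follows: the functions
`φ^* x'` and `φ^* y'` in `k(E)` are the affine coordinates of `φ`, so `φ` sends an affine point `P`
to their values at `P` if both are regular at `P`, and to the point at infinity otherwise.
(A function is regular at `P` with value `v` if it can be written as `a / b` with polynomials
`a`, `b` in `x` and `y` such that `b` does not vanish at `P` and `a(P) / b(P) = v`.) -/
structure Isogeny {k : Type u} [Field k] (E E' : WeierstrassCurve k)
    [E.IsElliptic] [E'.IsElliptic] where
  /-- The pullback of rational functions; it is injective, which says that `φ` is not constant. -/
  pullback : E'.toAffine.FunctionField →ₐ[k] E.toAffine.FunctionField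
  /-- The homomorphism on geometric points. -/
  onPoints : GeomPoint E →+ GeomPoint E'
  onPoints_eq_some_iff : ∀ (x y : AlgebraicClosure k)
    (h : (E.baseChange (AlgebraicClosure k)).toAffine.Nonsingular x y)
    (x' y' : AlgebraicClosure k)
    (h' : (E'.baseChange (AlgebraicClosure k)).toAffine.Nonsingular x' y'),
    onPoints (Affine.Point.some x y h) = Affine.Point.some x' y' h' ↔
      ∃ a b c : k[X][Y], aevalAeval x y b ≠ 0 ∧
        pullback (xFun E') = polyFun E a / polyFun E b ∧
        pullback (yFun E') = polyFun E c / polyFun E b ∧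
        x' = aevalAeval x y a / aevalAeval x y b ∧
        y' = aevalAeval x y c / aevalAeval x y b

/-- The degree `[k(E) : φ^* k(E')]` of an isogeny. -/
noncomputable def Isogeny.degree {k : Type u} [Field k] {E E' : WeierstrassCurve k}
    [E.IsElliptic] [E'.IsElliptic] (φ : Isogeny E E') : ℕ :=
  Module.finrank φ.pullback.fieldRange E.toAffine.FunctionField

/-- An `ℓ`-isogeny chain `E₀ → E₁ → ⋯ → Eₙ` of length `n` over `k`. -/
structure IsogenyChain (k : Type u) [Field k] (ℓ n : ℕ) where
  /-- The curves `E₀, …, Eₙ`. -/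
  curve : Fin (n + 1) → WeierstrassCurve k
  isElliptic : ∀ i, (curve i).IsElliptic
  /-- The isogenies `φᵢ : Eᵢ → Eᵢ₊₁` for `i < n`. -/
  isog : ∀ (i : ℕ) (hi : i < n), Isogeny (curve ⟨i, by omega⟩) (curve ⟨i + 1, by omega⟩)
  degree_isog : ∀ (i : ℕ) (hi : i < n), (isog i hi).degree = ℓ

attribute [instance] IsogenyChain.isElliptic

/-- The composite `φₘ₋₁ ∘ ⋯ ∘ φ₀ : E₀(k̄) → Eₘ(k̄)` of the first `m` isogenies of a chain. -/
noncomputable def IsogenyChain.compositeTo {k : Type u} [Field k] {ℓ n : ℕ}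
    (c : IsogenyChain k ℓ n) :
    ∀ (m : ℕ) (hm : m ≤ n), GeomPoint (c.curve ⟨0, by omega⟩) →+ GeomPoint (c.curve ⟨m, by omega⟩)
  | 0, _ => AddMonoidHom.id _
  | m + 1, hm => (c.isog m (by omega)).onPoints.comp (c.compositeTo m (by omega))

/-- The composite `φₙ₋₁ ∘ ⋯ ∘ φ₀ : E₀(k̄) → Eₙ(k̄)` of all isogenies of a chain. -/
noncomputable def IsogenyChain.composite {k : Type u} [Field k] {ℓ n : ℕ}
    (c : IsogenyChain k ℓ n) :
    GeomPoint (c.curve ⟨0, by omega⟩) →+ GeomPoint (c.curve ⟨n, by omega⟩) :=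
  c.compositeTo n le_rfl

/-- A chain is without backtracking if `ker (φᵢ₊₁ ∘ φᵢ) ≠ Eᵢ[ℓ]` for any two consecutive
isogenies `φᵢ`, `φᵢ₊₁`, where `Eᵢ[ℓ] = {P ∈ Eᵢ(k̄) | ℓ P = O}`. -/
def IsogenyChain.WithoutBacktracking {k : Type u} [Field k] {ℓ n : ℕ}
    (c : IsogenyChain k ℓ n) : Prop :=
  ∀ (i : ℕ) (hi : i + 1 < n),
    ((c.isog (i + 1) hi).onPoints.comp (c.isog i (by omega)).onPoints).ker ≠
      AddSubgroup.torsionBy (GeomPoint (c.curve ⟨i, by omega⟩)) (ℓ : ℤ)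

end EllipticIsogeny

/-! ### Kernels of composites of homomorphisms of abelian groups, and their cyclicity. -/

section GroupTheory

variable {A B C D : Type*} [AddCommGroup A] [AddCommGroup B] [AddCommGroup C] [AddCommGroup D]

/-! Each isogeny of the chain is surjective on geometric points with kernel of order ℓ, so m
consecutive ones have a composite with kernel of order ℓ^m. If the chain backtracks at i, a subgroup
of the kernel surjects onto E_i[ℓ], which then has order ℓ² and is killed by ℓ; so the kernel is not
cyclic (`not_isAddCyclic_ker_comp`). Conversely, cyclicity propagates one isogeny at a time. As
E_i[ℓ] has at most ℓ² elements, a kernel of order ℓ² different from it contains some w with ℓw ≠ 0.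
For a lift z of w to E_0, ℓz generates the previous cyclic kernel, and z generates the next one
(`isAddCyclic_ker_comp_of_isAddCyclic`).

The geometric input is a count on x-coordinates. If a homomorphism acts on x as a fraction A/B in
lowest terms, of degree d > 0, its general fibre corresponds to the roots of A - cB. Hence it is
surjective with at most d elements in the kernel, and exactly d if d ≠ 0 in the field
(`HasXMap.card_ker_eq`). An isogeny commutes with negation, so it acts on x in this way, and
comparing field degrees over k(x) shows that d is its degree. Multiplication by n acts with d = n²,
by a recursion built on the formulas for the x-coordinates of P + Q and P - Q; this bounds E[ℓ]. -/

theorem AddMonoidHom.card_ker_comp {g : A →+ B} (hg : Function.Surjective g) (f : B →+ C) :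
    Nat.card (f.comp g).ker = Nat.card f.ker * Nat.card g.ker := by
  let r : (f.comp g).ker →+ f.ker :=
    (g.comp (f.comp g).ker.subtype).codRestrict f.ker fun x => x.2
  have hr : Function.Surjective r := fun ⟨y, hy⟩ => by
    obtain ⟨x, rfl⟩ := hg y
    exact ⟨⟨x, hy⟩, rfl⟩
  have hle : g.ker ≤ (f.comp g).ker := fun x hx => by
    simp only [AddMonoidHom.mem_ker, AddMonoidHom.comp_apply] at hx ⊢
    rw [hx, map_zero]
  have hker : r.ker = g.ker.addSubgroupOf (f.comp g).ker := by
    ext x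
    exact Subtype.ext_iff
  rw [AddSubgroup.card_eq_card_quotient_mul_card_addSubgroup r.ker,
    Nat.card_congr (QuotientAddGroup.quotientKerEquivOfSurjective r hr).toEquiv, hker,
    Nat.card_congr (AddSubgroup.addSubgroupOfEquivOfLe hle).toEquiv]

theorem AddMonoidHom.nsmul_eq_zero_of_card_ker {h : A →+ B} {n : ℕ} (hh : Nat.card h.ker = n) {x : A}
    (hx : h x = 0) : n • x = 0 := by
  have := card_nsmul_eq_zero' (x := (⟨x, hx⟩ : h.ker))
  rw [hh] at this
  simpa using congrArg Subtype.val this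

/-- Lift w to z and let u generate the kernel of `f.comp g`. Then ℓz = ju with j prime to ℓ, so ℓz
has order ℓ^m and z has order ℓ^(m+1), the order of the larger kernel. -/
theorem isAddCyclic_ker_comp_of_isAddCyclic {ℓ m : ℕ} (hℓ : ℓ.Prime) {g : A →+ B} {f : B →+ C}
    {f' : C →+ D} (hg : Function.Surjective g) (hf : Function.Surjective f)
    (hfℓ : Nat.card f.ker = ℓ) (hfℓ' : Nat.card f'.ker = ℓ)
    (hcard : Nat.card (f.comp g).ker = ℓ ^ m) (hcyc : IsAddCyclic (f.comp g).ker)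
    {w : B} (hw : f' (f w) = 0) (hℓw : ℓ • w ≠ 0) :
    IsAddCyclic (f'.comp (f.comp g)).ker := by
  obtain ⟨z, rfl⟩ := hg w
  have hz : z ∈ (f'.comp (f.comp g)).ker := hw
  have hzK : ℓ • z ∈ (f.comp g).ker := by
    simp only [AddMonoidHom.mem_ker, map_nsmul, AddMonoidHom.comp_apply]
    exact AddMonoidHom.nsmul_eq_zero_of_card_ker hfℓ' hw
  have : Finite (f.comp g).ker := 
    Nat.finite_of_card_ne_zero (by rw [hcard]; exact pow_ne_zero _ hℓ.ne_zero)
  obtain ⟨u, hu⟩ := hcyc.exists_zsmul_surjective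
  obtain ⟨j, hj⟩ := hu ⟨ℓ • z, hzK⟩
  replace hj : j • u = ⟨ℓ • z, hzK⟩ := hj
  have huo : addOrderOf u = ℓ ^ m := by
    rw [← hcard]
    exact addOrderOf_eq_card_of_forall_mem_zmultiples fun x => by
      obtain ⟨i, hi⟩ := hu x
      exact AddSubgroup.mem_zmultiples_iff.mpr ⟨i, hi⟩
  -- If j = ℓi, applying g gives ℓw = ℓ(i g(u)), which is 0 because g(u) lies in the kernel of f, of
  -- order ℓ.
  have hjℓ : ¬ (ℓ : ℤ) ∣ j := by
    rintro ⟨i, rfl⟩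
    apply hℓw
    have h1 : ℓ • z = (ℓ : ℤ) • (i • (u : A)) := by
      have := congrArg Subtype.val hj
      simp only [AddSubgroup.coe_zsmul] at this
      rw [← this, mul_smul]
    rw [← map_nsmul, h1, map_zsmul, natCast_zsmul]
    refine AddMonoidHom.nsmul_eq_zero_of_card_ker hfℓ ?_
    rw [map_zsmul, map_zsmul]
    have : f (g u) = 0 := u.2
    rw [this, smul_zero]
  have hord : addOrderOf (ℓ • z) = ℓ ^ m := by
    have h1 : addOrderOf (⟨ℓ • z, hzK⟩ : (f.comp g).ker) = addOrderOf (ℓ • z) :=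
      (AddSubgroup.addOrderOf_coe _).symm
    rw [← h1, ← hj, ← huo]
    refine Nat.dvd_antisymm ?_ ?_
    · exact addOrderOf_dvd_of_nsmul_eq_zero (by
        rw [smul_comm, addOrderOf_nsmul_eq_zero, smul_zero])
    · have hcop : IsCoprime (ℓ ^ m : ℤ) j := by
        apply IsCoprime.pow_left
        exact (Nat.prime_iff_prime_int.mp hℓ).irreducible.coprime_iff_not_dvd.mpr hjℓ
      obtain ⟨a, b, hab⟩ := hcop
      refine addOrderOf_dvd_of_nsmul_eq_zero ?_
      have h2 : (ℓ ^ m : ℤ) • u = 0 := by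
        have := addOrderOf_nsmul_eq_zero u
        rw [huo] at this
        exact_mod_cast this
      have h3 : u = b • (j • u) := by
        conv_lhs => rw [← one_zsmul u, ← hab, add_smul, mul_smul, h2, smul_zero, zero_add, mul_smul]
      calc addOrderOf (j • u) • u = addOrderOf (j • u) • (b • (j • u)) := congrArg _ h3
        _ = 0 := by rw [smul_comm, addOrderOf_nsmul_eq_zero, smul_zero]
  have hzo : addOrderOf z = ℓ ^ (m + 1) := by
    -- The order of ℓz determines that of z only when ℓ divides the latter; the case m = 0 shows
    -- that this needs z ≠ 0.
    have hd : ℓ ∣ addOrderOf z := by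
      by_contra hnd
      have hc : (addOrderOf z).Coprime ℓ := ((Nat.Prime.coprime_iff_not_dvd hℓ).mpr hnd).symm
      have h4 : addOrderOf z ∣ ℓ ^ (m + 1) := addOrderOf_dvd_of_nsmul_eq_zero (by
        rw [pow_succ, mul_smul, ← hord, addOrderOf_nsmul_eq_zero])
      have h5 : addOrderOf z = 1 := Nat.Coprime.eq_one_of_dvd (hc.pow_right _) h4
      apply hℓw
      rw [AddMonoid.addOrderOf_eq_one_iff.mp h5, map_zero, smul_zero]
    rw [addOrderOf_nsmul_of_dvd hℓ.ne_zero hd] at hord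
    rw [← Nat.div_mul_cancel hd, hord, pow_succ]
  have hcard' : Nat.card (f'.comp (f.comp g)).ker = ℓ ^ (m + 1) := by
    rw [AddMonoidHom.card_ker_comp (g := f.comp g) (by exact hf.comp hg), hcard, hfℓ', ← pow_succ']
  have : Finite (f'.comp (f.comp g)).ker :=
    Nat.finite_of_card_ne_zero (by rw [hcard']; exact pow_ne_zero _ hℓ.ne_zero)
  refine isAddCyclic_of_addOrderOf_eq_card (⟨z, hz⟩ : (f'.comp (f.comp g)).ker) ?_
  rw [hcard', ← hzo]
  exact (AddSubgroup.addOrderOf_coe _).symm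

theorem card_dvd_of_isAddCyclic_of_nsmul_eq_zero {G : Type*} [AddCommGroup G] [IsAddCyclic G]
    {ℓ : ℕ} (h : ∀ x : G, ℓ • x = 0) : Nat.card G ∣ ℓ := by
  obtain ⟨u, hu⟩ := IsAddCyclic.exists_zsmul_surjective (G := G)
  rw [← addOrderOf_eq_card_of_forall_mem_zmultiples (g := u) fun x => by
      obtain ⟨i, hi⟩ := hu x
      exact AddSubgroup.mem_zmultiples_iff.mpr ⟨i, hi⟩]
  exact addOrderOf_dvd_of_nsmul_eq_zero (h u)

/-- Cyclicity would pass to the subgroup `(f.comp g).ker` and to its image `f.ker`; but a cyclic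
group killed by ℓ has order dividing ℓ, not ℓ². -/
theorem not_isAddCyclic_ker_comp {ℓ : ℕ} (hℓ : ℓ.Prime) {g : A →+ B} {f : B →+ C}
    (hg : Function.Surjective g) (hcard : Nat.card f.ker = ℓ ^ 2)
    (hf : f.ker = AddSubgroup.torsionBy B (ℓ : ℤ)) {K : AddSubgroup A} (hK : (f.comp g).ker ≤ K) :
    ¬ IsAddCyclic K := by
  intro hcyc
  have h1 : IsAddCyclic (f.comp g).ker :=
    isAddCyclic_of_injective (AddSubgroup.inclusion hK) (AddSubgroup.inclusion_injective hK)
  let r : (f.comp g).ker →+ f.ker :=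
    (g.comp (f.comp g).ker.subtype).codRestrict f.ker fun x => x.2
  have hr : Function.Surjective r := fun ⟨y, hy⟩ => by
    obtain ⟨x, rfl⟩ := hg y
    exact ⟨⟨x, hy⟩, rfl⟩
  have h2 : IsAddCyclic f.ker := isAddCyclic_of_surjective r hr
  have h3 := card_dvd_of_isAddCyclic_of_nsmul_eq_zero (G := f.ker) (ℓ := ℓ) fun ⟨x, hx⟩ => by
    rw [hf] at hx
    have : (ℓ : ℤ) • x = 0 := by simpa using hx
    ext
    simpa using this
  rw [hcard] at h3
  have := Nat.le_of_dvd hℓ.pos h3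
  nlinarith [hℓ.two_le]

end GroupTheory

/-! ### Homomorphisms given by a rational function on x-coordinates: fibres, surjectivity, kernels.
-/

namespace WeierstrassCurve.Affine.Point

variable {F : Type u} [Field F]

/-- If the Wronskian vanishes, coprimality gives A ∣ A' and B ∣ B', so A' = B' = 0 by degrees. Then
the characteristic divides the larger degree. This is the separability of A/B. -/
theorem _root_.Polynomial.derivative_mul_sub_mul_derivative_ne_zero {A B : F[X]}
    (hAB : IsCoprime A B) (hpos : 0 < max A.natDegree B.natDegree)
    (hF : ((max A.natDegree B.natDegree : ℕ) : F) ≠ 0) :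
    derivative A * B - A * derivative B ≠ 0 := by
  intro h0
  have key : ∀ {P Q : F[X]}, IsCoprime P Q → derivative P * Q = P * derivative Q →
      derivative P = 0 := by
    intro P Q hPQ h
    by_contra hne
    have hP : P.natDegree ≠ 0 := fun h1 => hne (derivative_of_natDegree_zero h1)
    have hdvd : P ∣ derivative P := hPQ.dvd_of_dvd_mul_right ⟨_, h⟩
    exact absurd (natDegree_le_of_dvd hdvd hne) (natDegree_derivative_lt hP).not_ge
  have key2 : ∀ {P : F[X]}, derivative P = 0 → 0 < P.natDegree → (P.natDegree : F) = 0 := by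
    intro P hP hpos
    have h1 := coeff_derivative P (P.natDegree - 1)
    rw [hP, coeff_zero, Nat.sub_add_cancel hpos, coeff_natDegree, Nat.cast_sub hpos] at h1
    rcases mul_eq_zero.mp h1.symm with h2 | h2
    · rw [leadingCoeff_eq_zero] at h2
      simp [h2] at hpos
    · simpa using h2
  rcases max_choice A.natDegree B.natDegree with h | h
  · rw [h] at hF hpos
    exact hF (key2 (key hAB (by linear_combination h0)) hpos)
  · rw [h] at hF hpos
    exact hF (key2 (key hAB.symm (by linear_combination -h0)) hpos)

section Points

variable (W : WeierstrassCurve F)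

theorem finite_xRep_mem {S : Set F} (hS : S.Finite) :
    {P : W.toAffine.Point | P.xRep 0 ∈ S}.Finite := by
  -- The origin has `xRep` equal to `![1, 0]`, so it too belongs to the set when 1 ∈ S.
  have h1 : ((fun x : F => ![x, 1]) '' S ∪ {![1, 0]}).Finite :=
    (hS.image _).union (Set.finite_singleton _)
  refine (h1.preimage' (f := xRep (W' := W.toAffine)) fun b _ => ?_).subset ?_
  · by_cases hb : ∃ P : W.toAffine.Point, P.xRep = b
    · obtain ⟨P, rfl⟩ := hb
      refine (Set.toFinite {P, -P}).subset fun Q hQ => ?_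
      exact eq_or_eq_neg_of_xRep_eq_xRep hQ
    · refine Set.finite_empty.subset fun Q hQ => hb ⟨Q, hQ⟩
  · rintro (_ | ⟨x, y, h⟩) hP
    · right; rfl
    · left; exact ⟨x, hP, rfl⟩

theorem exists_eq_some [IsAlgClosed F] [W.IsElliptic] (x : F) :
    ∃ (y : F) (h : W.toAffine.Nonsingular x y), (some x y h).xRep 0 = x := by
  have hd : (W.toAffine.polynomial.map (evalRingHom x)).natDegree = 2 := by
    rw [W.toAffine.monic_polynomial.natDegree_map, natDegree_polynomial]
  obtain ⟨y, hy⟩ := IsAlgClosed.exists_root (W.toAffine.polynomial.map (evalRingHom x))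
    (fun h => by
      rw [natDegree_eq_of_degree_eq_some (n := 0) h] at hd
      omega)
  have he : W.toAffine.Equation x y := by
    rwa [Equation, ← eval₂_evalRingHom, ← eval_map]
  exact ⟨y, equation_iff_nonsingular.mp he, rfl⟩

instance [IsAlgClosed F] [W.IsElliptic] : Infinite W.toAffine.Point := by
  choose y h hx using exists_eq_some W
  have : Infinite F := IsAlgClosed.instInfinite
  refine Infinite.of_injective (fun x => some x (y x) (h x)) fun a b hab => ?_
  simpa using congrArg (fun P => xRep P 0) hab

/-- If 4x³ + b₂x² + 2b₄x + b₆ were zero, then b₂ = b₆ = 2b₄ = 0 would reduce Δ to -8b₄³ = 0. The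
argument covers every characteristic. -/
theorem Ψ₂Sq_ne_zero_of_isElliptic [W.IsElliptic] : W.Ψ₂Sq ≠ 0 := by
  intro h
  have h3 : W.Ψ₂Sq.coeff 3 = 0 := by rw [h, coeff_zero]
  have h2 : W.Ψ₂Sq.coeff 2 = 0 := by rw [h, coeff_zero]
  have h1 : W.Ψ₂Sq.coeff 1 = 0 := by rw [h, coeff_zero]
  have h0 : W.Ψ₂Sq.coeff 0 = 0 := by rw [h, coeff_zero]
  simp [Ψ₂Sq, coeff_X, coeff_C] at h3 h2 h1 h0
  apply W.isUnit_Δ.ne_zero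
  rw [Δ, h2, h0]
  have h1' : 2 * W.b₄ = 0 := by simpa using h1
  linear_combination -4 * W.b₄ ^ 2 * h1'

/-- On the curve (2y + a₁x + a₃)² equals `Ψ₂Sq` at x, so 2-torsion points lie over its roots. -/
theorem finite_xRep_of_neg_eq_self [W.IsElliptic] :
    ∃ S : Set F, S.Finite ∧ ∀ x y, W.toAffine.Nonsingular x y →
      W.toAffine.negY x y = y → x ∈ S := by
  refine ⟨{x | W.Ψ₂Sq.IsRoot x}, finite_setOfPred_isRoot (Ψ₂Sq_ne_zero_of_isElliptic W), fun x y h hy => ?_⟩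
  have he := (equation_iff ..).mp h.1
  simp only [negY] at hy
  simp [Ψ₂Sq, b₂, b₄, b₆]
  linear_combination (-4) * he + (W.a₁ * x + W.a₃ + 2 * y) * (-1) * hy

end Points

variable {W W' : WeierstrassCurve F}

/-- `f` is given on `x`-coordinates by the rational function `A / B`, up to finitely many points. -/
def HasXMap [DecidableEq F] (f : W.toAffine.Point →+ W'.toAffine.Point) (A B : F[X]) : Prop :=
  ∃ S : Set F, S.Finite ∧ ∀ x y (h : W.toAffine.Nonsingular x y), x ∉ S →
    B.eval x ≠ 0 ∧ ∃ x' y' h', f (some x y h) = some x' y' h' ∧ x' * B.eval x = A.eval x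


theorem eq_some_or_eq_neg_some_of_xRep {P : W.toAffine.Point} {x y : F} {h : W.toAffine.Nonsingular x y}
    (hP : P.xRep 0 = x) (hP0 : P ≠ 0) : P = some x y h ∨ P = -some x y h := by
  apply eq_or_eq_neg_of_xRep_eq_xRep
  rcases P with _ | ⟨a, b, c⟩
  · exact absurd rfl hP0
  · have : a = x := hP
    simp [this]

variable [DecidableEq F] {f : W.toAffine.Point →+ W'.toAffine.Point} {A B : F[X]}

/-- Over a root of A - x'B lie the points P and -P, mapping to (x', y') and its negative. When these
two differ, exactly one point over each root belongs to the fibre. -/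
theorem HasXMap.exists_fibre [IsAlgClosed F] [W.IsElliptic] [W'.IsElliptic]
    (hf : HasXMap f A B) (hAB : IsCoprime A B) {d : ℕ}
    (hd : max A.natDegree B.natDegree = d) (hd0 : 0 < d) :
    ∃ S : Set F, S.Finite ∧ ∀ x' y' (h' : W'.toAffine.Nonsingular x' y'), x' ∉ S →
      (A - C x' * B).natDegree = d ∧
      Nat.card (f ⁻¹' {some x' y' h'}) = (A - C x' * B).roots.toFinset.card ∧
      (derivative A * B - A * derivative B ≠ 0 → (A - C x' * B).roots.Nodup) := by
  obtain ⟨S, hS, hfS⟩ := hf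
  obtain ⟨T, hT, hTy⟩ := finite_xRep_of_neg_eq_self W'
  set w := derivative A * B - A * derivative B with hw
  have hbad : {P : W.toAffine.Point | P.xRep 0 ∈ S}.Finite := finite_xRep_mem W hS
  let q : F → F := fun r => A.eval r / B.eval r
  have hRw : {r | w ≠ 0 ∧ w.IsRoot r}.Finite := by
    by_cases h0 : w = 0
    · simp [h0]
    · exact (finite_setOfPred_isRoot h0).subset fun r hr => hr.2
  -- Excluded values x': images of points over S, 2-torsion abscissae, the value at which A - x'B
  -- drops in degree, values of A/B on S, and critical values of A/B, where double roots occur.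
  refine ⟨(fun P => (f P).xRep 0) '' {P : W.toAffine.Point | P.xRep 0 ∈ S} ∪ T ∪
    {A.coeff d / B.coeff d} ∪ q '' S ∪ q '' {r | w ≠ 0 ∧ w.IsRoot r},
    ((((hbad.image _).union hT).union (Set.finite_singleton _)).union (hS.image _)).union
      (hRw.image _), fun x' y' h' hx' => ?_⟩
  simp only [Set.mem_union, not_or, Set.mem_singleton_iff] at hx'
  obtain ⟨⟨⟨⟨hx1, hx2⟩, hx3⟩, hx4⟩, hx5⟩ := hx'
  have hdeg : (A - C x' * B).natDegree = d := by
    apply natDegree_eq_of_le_of_coeff_ne_zero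
    · refine (natDegree_sub_le _ _).trans (max_le ?_ ((natDegree_C_mul_le _ _).trans ?_))
      · exact hd ▸ le_max_left _ _
      · exact hd ▸ le_max_right _ _
    · rw [coeff_sub, coeff_C_mul]
      intro h0
      by_cases hB : B.coeff d = 0
      · have hA : A.coeff d = 0 := by simpa [hB] using h0
        rcases max_choice A.natDegree B.natDegree with h1 | h1
        · rw [← hd, h1, coeff_natDegree, leadingCoeff_eq_zero] at hA
          simp [hA] at h1
          rw [hA] at hd
          simp at hd
          omega
        · rw [← hd, h1, coeff_natDegree, leadingCoeff_eq_zero] at hB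
          rw [hB] at hd h1
          simp at hd h1
          omega
      · apply hx3
        field_simp
        linear_combination -h0
  have hne : A - C x' * B ≠ 0 := fun h0 => by
    rw [h0, natDegree_zero] at hdeg
    omega
  have hrootB : ∀ r, (A - C x' * B).IsRoot r → B.eval r ≠ 0 ∧ x' = q r := by
    intro r hr
    have hr' : A.eval r = x' * B.eval r := by
      simpa [IsRoot, sub_eq_zero] using hr
    have hB : B.eval r ≠ 0 := by
      intro hB
      obtain ⟨a, b, hab⟩ := hAB
      have := congrArg (eval r) hab
      simp [hr', hB] at this
    refine ⟨hB, ?_⟩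
    simp only [q, hr']
    field_simp
  have hself : -some x' y' h' ≠ some x' y' h' := by
    intro h0
    rw [neg_some, some.injEq] at h0
    exact hx2 (hTy x' y' h' h0.2)
  have hfib : ∀ P, f P = some x' y' h' →
      P ≠ 0 ∧ P.xRep 0 ∉ S ∧ (A - C x' * B).IsRoot (P.xRep 0) := by
    rintro (_ | ⟨x, y, h⟩) hP
    · rw [← zero_def, _root_.map_zero] at hP
      exact absurd hP.symm (some_ne_zero _)
    · have hxS : x ∉ S := fun hxS => hx1 ⟨some x y h, hxS, congrArg (xRep · 0) hP⟩
      obtain ⟨-, x'', y'', h'', h1, h2⟩ := hfS x y h hxS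
      rw [h1, some.injEq] at hP
      refine ⟨some_ne_zero _, hxS, ?_⟩
      change (A - C x' * B).IsRoot x
      simp [IsRoot, ← h2, hP.1]
  refine ⟨hdeg, ?_, fun hw0 => ?_⟩
  · have hc : Nat.card {x // x ∈ (A - C x' * B).roots.toFinset} =
      (A - C x' * B).roots.toFinset.card := by
      rw [Nat.card_eq_fintype_card, Fintype.card_coe]
    rw [← hc]
    refine Nat.card_congr (Equiv.ofBijective (fun P => ⟨P.1.xRep 0, ?_⟩) ⟨?_, ?_⟩)
    · rw [Multiset.mem_toFinset, mem_roots hne]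
      exact (hfib P.1 P.2).2.2
    · rintro ⟨P, hP⟩ ⟨Q, hQ⟩ hPQ
      have h1 := hfib P hP
      rcases P with _ | ⟨x, y, h⟩
      · exact absurd rfl h1.1
      · rcases eq_some_or_eq_neg_some_of_xRep (h := h) (P := Q) (Subtype.ext_iff.mp hPQ).symm (hfib Q hQ).1
          with h2 | h2
        · exact Subtype.ext h2.symm
        · rw [Set.mem_preimage, Set.mem_singleton_iff] at hP hQ
          rw [h2, map_neg, hP] at hQ
          exact absurd hQ hself
    · rintro ⟨r, hr⟩
      rw [Multiset.mem_toFinset, mem_roots hne] at hr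
      obtain ⟨hBr, hqr⟩ := hrootB r hr
      have hrS : r ∉ S := fun h => hx4 ⟨r, h, hqr.symm⟩
      obtain ⟨y, h, -⟩ := exists_eq_some W r
      obtain ⟨-, x'', y'', h'', h1, h2⟩ := hfS r y h hrS
      have h3 : x'' = x' := by
        rw [hqr, eq_div_iff hBr, h2]
      rcases eq_some_or_eq_neg_some_of_xRep (P := f (some r y h)) (h := h') (by rw [h1, ← h3]; rfl)
        (by rw [h1]; exact some_ne_zero _) with h4 | h4
      · exact ⟨⟨some r y h, h4⟩, rfl⟩
      · refine ⟨⟨-some r y h, ?_⟩, rfl⟩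
        rw [Set.mem_preimage, map_neg, h4, neg_neg]
        rfl
  · rw [Multiset.nodup_iff_count_le_one]
    intro r
    rw [count_roots]
    by_contra hlt
    rw [not_le, one_lt_rootMultiplicity_iff_isRoot hne] at hlt
    obtain ⟨hr, hr'⟩ := hlt
    obtain ⟨hBr, hqr⟩ := hrootB r hr
    refine hx5 ⟨r, ⟨hw0, ?_⟩, hqr.symm⟩
    simp only [IsRoot, derivative_sub, derivative_mul, derivative_C, zero_mul, zero_add,
      eval_sub, eval_mul, eval_C] at hr hr'
    simp only [IsRoot, hw, eval_sub, eval_mul]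
    linear_combination (eval r B) * hr' - (eval r (derivative B)) * hr

theorem finite_ker_of_hasXMap (hf : HasXMap f A B) : Finite f.ker := by
  obtain ⟨S, hS, hfS⟩ := hf
  refine ((finite_xRep_mem W hS).union (Set.finite_singleton 0)).subset fun P hP => ?_
  rcases P with _ | ⟨x, y, h⟩
  · right; rfl
  · left
    by_contra hx
    obtain ⟨-, x', y', h', h1, -⟩ := hfS x y h hx
    exact some_ne_zero h' (h1.symm.trans hP)

theorem card_fibre_eq_card_ker (P : W.toAffine.Point) :
    Nat.card (f ⁻¹' {f P}) = Nat.card f.ker := by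
  refine Nat.card_congr ⟨fun Q => ⟨Q.1 - P, ?_⟩, fun Q => ⟨Q.1 + P, ?_⟩, fun Q => ?_, fun Q => ?_⟩
  · rw [AddMonoidHom.mem_ker, map_sub, sub_eq_zero]
    exact Q.2
  · rw [Set.mem_preimage, map_add, (AddMonoidHom.mem_ker).mp Q.2, zero_add]
    rfl
  · simp
  · simp

section

variable [IsAlgClosed F] [W.IsElliptic] [W'.IsElliptic]

theorem HasXMap.surjective (hf : HasXMap f A B) (hAB : IsCoprime A B)
    (hpos : 0 < max A.natDegree B.natDegree) :
    Function.Surjective f := by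
  obtain ⟨S, hS, hSf⟩ := hf.exists_fibre hAB rfl hpos
  have hcof : ((f.range : Set W'.toAffine.Point)ᶜ).Finite := by
    refine ((finite_xRep_mem W' hS).union (Set.finite_singleton 0)).subset fun P hP => ?_
    rcases P with _ | ⟨x, y, h⟩
    · right; rfl
    · left
      by_contra hx
      obtain ⟨h1, h2, -⟩ := hSf x y h hx
      obtain ⟨r, hr⟩ := IsAlgClosed.exists_root (A - C x * B) (fun h0 => by
        rw [natDegree_eq_of_degree_eq_some (n := 0) h0] at h1
        omega)
      have hne : A - C x * B ≠ 0 := fun h0 => by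
        rw [h0, natDegree_zero] at h1
        omega
      have h3 : 0 < Nat.card (f ⁻¹' {some x y h}) := by
        rw [h2, Finset.card_pos]
        exact ⟨r, by rwa [Multiset.mem_toFinset, mem_roots hne]⟩
      obtain ⟨⟨P, hP'⟩⟩ := (Nat.card_pos_iff.mp h3).1
      exact hP ⟨P, hP'⟩
  have hinf : (f.range : Set W'.toAffine.Point).Infinite := by simpa using hcof.infinite_compl
  intro P
  by_contra hP
  -- The range is a subgroup with finite complement; if it missed P, its infinite coset through P
  -- would lie in that complement.
  refine (hinf.image (f := fun Q => P + Q) (add_right_injective P).injOn) (hcof.subset ?_)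
  rintro _ ⟨Q, hQ, rfl⟩ h
  exact hP ((AddSubgroup.add_mem_cancel_right f.range hQ).mp h)

theorem HasXMap.exists_card_ker (hf : HasXMap f A B) (hAB : IsCoprime A B)
    (hpos : 0 < max A.natDegree B.natDegree) :
    ∃ c : F, (A - C c * B).natDegree = max A.natDegree B.natDegree ∧
      Nat.card f.ker = (A - C c * B).roots.toFinset.card ∧
      (derivative A * B - A * derivative B ≠ 0 → (A - C c * B).roots.Nodup) := by
  obtain ⟨S, hS, hSf⟩ := hf.exists_fibre hAB rfl hpos
  have : Infinite F := IsAlgClosed.instInfinite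
  obtain ⟨c, hc⟩ := hS.exists_notMem
  obtain ⟨y, h, -⟩ := exists_eq_some W' c
  obtain ⟨P, hP⟩ := hf.surjective hAB hpos (some c y h)
  obtain ⟨h1, h2, h3⟩ := hSf c y h hc
  exact ⟨c, h1, by rw [← h2, ← hP, card_fibre_eq_card_ker], h3⟩

theorem HasXMap.card_ker_le (hf : HasXMap f A B) (hAB : IsCoprime A B)
    (hpos : 0 < max A.natDegree B.natDegree) :
    Nat.card f.ker ≤ max A.natDegree B.natDegree := by
  obtain ⟨c, h1, h2, -⟩ := hf.exists_card_ker hAB hpos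
  rw [h2, ← h1]
  exact (Multiset.toFinset_card_le _).trans (card_roots' _)

theorem HasXMap.card_ker_eq (hf : HasXMap f A B) (hAB : IsCoprime A B)
    (hpos : 0 < max A.natDegree B.natDegree)
    (hF : ((max A.natDegree B.natDegree : ℕ) : F) ≠ 0) :
    Nat.card f.ker = max A.natDegree B.natDegree := by
  obtain ⟨c, h1, h2, h3⟩ := hf.exists_card_ker hAB hpos
  rw [h2, Multiset.toFinset_card_of_nodup (h3 (derivative_mul_sub_mul_derivative_ne_zero hAB hpos hF)), ← h1]
  exact (IsAlgClosed.splits _).natDegree_eq_card_roots.symm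

end

end WeierstrassCurve.Affine.Point

/-! ### Multiplication by n on x-coordinates, and the bound n² for the n-torsion. -/

namespace WeierstrassCurve.Affine.Point

section AddSub

variable {R : Type*} [CommRing R] (W : WeierstrassCurve R) (v : Fin 3 → R)

theorem eval_addSubMap_zero : (addSubMap W 0).eval v =
    v 0 ^ 2 - W.b₄ * v 0 * v 2 - W.b₆ * v 1 * v 2 - W.b₈ * v 2 ^ 2 := by
  simp [addSubMap]

theorem eval_addSubMap_one : (addSubMap W 1).eval v =
    2 * v 1 * v 0 + W.b₂ * v 0 * v 2 + W.b₄ * v 1 * v 2 + W.b₆ * v 2 ^ 2 := by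
  simp [addSubMap]

theorem eval_addSubMap_two : (addSubMap W 2).eval v = v 1 ^ 2 - 4 * v 0 * v 2 := by
  simp [addSubMap]

end AddSub

section PolynomialPairs

variable {F : Type u} [Field F]

/-- The hypothesis says that (a : b) is a zero of the binary form Tv² - Suv + Du², which therefore
splits as (av - bu)(a'v - b'u). -/
theorem exists_factor_of_isCoprime {R : Type*} [CommRing R] [IsDomain R] {a b S T D : R}
    (hab : IsCoprime a b) (h : T * b ^ 2 - S * a * b + D * a ^ 2 = 0) :
    ∃ a' b', T = a * a' ∧ S = a * b' + a' * b ∧ D = b * b' := by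
  have hT : a ∣ T := (hab.pow_right (n := 2)).dvd_of_dvd_mul_right
    ⟨S * b - D * a, by linear_combination h⟩
  have hD : b ∣ D := (hab.symm.pow_right (n := 2)).dvd_of_dvd_mul_right
    ⟨S * a - T * b, by linear_combination h⟩
  obtain ⟨a', rfl⟩ := hT
  obtain ⟨b', rfl⟩ := hD
  by_cases ha : a = 0
  · subst ha
    obtain ⟨u, hu⟩ := (isCoprime_zero_left.mp hab).exists_right_inv
    exact ⟨S * u, b', by ring, by linear_combination -S * hu, rfl⟩
  by_cases hb : b = 0
  · subst hb
    obtain ⟨u, hu⟩ := (isCoprime_zero_right.mp hab).exists_right_inv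
    exact ⟨a', S * u, rfl, by linear_combination -S * hu, by ring⟩
  · refine ⟨a', b', rfl, ?_, rfl⟩
    apply mul_left_cancel₀ (mul_ne_zero ha hb)
    linear_combination -h

/-- The larger of the degrees of `A` and `B` is `d`, and `A` and `B` do not both vanish. -/
def IsMaxDegree (A B : F[X]) (d : ℕ) : Prop :=
  A.natDegree ≤ d ∧ B.natDegree ≤ d ∧ (A.coeff d ≠ 0 ∨ B.coeff d ≠ 0)

theorem isMaxDegree_max {A B : F[X]} (h : A ≠ 0 ∨ B ≠ 0) :
    IsMaxDegree A B (max A.natDegree B.natDegree) := by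
  refine ⟨le_max_left _ _, le_max_right _ _, ?_⟩
  rcases le_total A.natDegree B.natDegree with h1 | h1
  · rw [max_eq_right h1]
    by_cases hB : B = 0
    · subst hB
      left
      have : A.natDegree = 0 := by simpa using h1
      rw [natDegree_zero, ← this, coeff_natDegree]
      simpa using h
    · right
      simpa using hB
  · rw [max_eq_left h1]
    by_cases hA : A = 0
    · subst hA
      right
      have : B.natDegree = 0 := by simpa using h1
      rw [natDegree_zero, ← this, coeff_natDegree]
      simpa using h
    · left
      simpa using hA

theorem IsMaxDegree.max_eq {A B : F[X]} {d : ℕ} (h : IsMaxDegree A B d) :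
    max A.natDegree B.natDegree = d := by
  refine le_antisymm (max_le h.1 h.2.1) ?_
  rcases h.2.2 with h1 | h1
  · exact le_max_of_le_left (le_natDegree_of_ne_zero h1)
  · exact le_max_of_le_right (le_natDegree_of_ne_zero h1)

theorem coeff_mul_of_isMaxDegree {A B A' B' : F[X]} {d d' : ℕ} (h : IsMaxDegree A B d)
    (h' : IsMaxDegree A' B' d') :
    (A * A').coeff (d + d') ≠ 0 ∨ (A * B' + A' * B).coeff (d + d') ≠ 0 ∨
      (B * B').coeff (d + d') ≠ 0 := by
  have e₁ := coeff_mul_add_eq_of_natDegree_le h.1 h'.1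
  have e₂ := coeff_mul_add_eq_of_natDegree_le h.1 h'.2.1
  have e₃ := coeff_mul_add_eq_of_natDegree_le h.2.1 h'.1
  have e₄ := coeff_mul_add_eq_of_natDegree_le h.2.1 h'.2.1
  rw [coeff_add, mul_comm A' B, e₁, e₂, e₃, e₄]
  rcases h.2.2 with h1 | h1 <;> rcases h'.2.2 with h2 | h2 <;> grind

theorem natDegree_mul_le_of_isMaxDegree {A B A' B' : F[X]} {d d' : ℕ} (h : IsMaxDegree A B d)
    (h' : IsMaxDegree A' B' d') :
    (A * A').natDegree ≤ d + d' ∧ (A * B' + A' * B).natDegree ≤ d + d' ∧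
      (B * B').natDegree ≤ d + d' := by
  refine ⟨natDegree_mul_le_of_le h.1 h'.1, natDegree_add_le_of_degree_le
    (natDegree_mul_le_of_le h.1 h'.2.1) ?_, natDegree_mul_le_of_le h.2.1 h'.2.1⟩
  rw [add_comm]
  exact natDegree_mul_le_of_le h'.1 h.2.1

theorem exists_eq_mul_xRep {W : WeierstrassCurve F} (Q : W.toAffine.Point) {a b : F} (hab : a ≠ 0 ∨ b ≠ 0)
    (h : Q.xRep 0 * b = Q.xRep 1 * a) : ∃ c ≠ 0, a = c * Q.xRep 0 ∧ b = c * Q.xRep 1 := by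
  rcases Q with _ | ⟨x, y, hxy⟩
  · have hb : b = 0 := by simpa [← zero_def] using h
    refine ⟨a, by simpa [hb] using hab, ?_, ?_⟩ <;> simp [← zero_def, hb]
  · have ha : x * b = a := by simpa using h
    refine ⟨b, fun hb => ?_, ?_, ?_⟩
    · rw [hb, mul_zero] at ha
      simp [hb, ← ha] at hab
    · simp [← ha, mul_comm]
    · simp

theorem eval_ne_zero_or_of_isCoprime {A B : F[X]} (h : IsCoprime A B) (x : F) :
    A.eval x ≠ 0 ∨ B.eval x ≠ 0 := by
  obtain ⟨u, v, huv⟩ := h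
  by_contra! h0
  have := congrArg (eval x) huv
  simp [h0.1, h0.2] at this

theorem isCoprime_of_eval_ne_zero_or [IsAlgClosed F] {A B : F[X]}
    (h : ∀ x, A.eval x ≠ 0 ∨ B.eval x ≠ 0) : IsCoprime A B := by
  rw [isCoprime_iff_aeval_ne_zero_of_isAlgClosed F F]
  simpa using h

theorem natDegree_mul_le_and_coeff_mul {s t : F[X]} {M : ℕ} (hs : s.natDegree ≤ M)
    (ht : t.natDegree ≤ M) (c : F) : (C c * s * t).natDegree ≤ M + M ∧
      (C c * s * t).coeff (M + M) = c * s.coeff M * t.coeff M := by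
  rw [mul_assoc, coeff_C_mul, coeff_mul_add_eq_of_natDegree_le hs ht, mul_assoc]
  exact ⟨(natDegree_C_mul_le _ _).trans (natDegree_mul_le_of_le hs ht), rfl⟩

end PolynomialPairs

variable {F : Type u} [Field F] [DecidableEq F] (W : WeierstrassCurve F)

theorem eval_addSubMap_sym2x_of_X_ne {x₁ y₁ x₂ y₂ : F} (h₁ : W.toAffine.Nonsingular x₁ y₁)
    (h₂ : W.toAffine.Nonsingular x₂ y₂) (hx : x₁ ≠ x₂) (i : Fin 3) :
    (addSubMap W i).eval ((some x₁ y₁ h₁).sym2x (some x₂ y₂ h₂)) =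
      (x₁ - x₂) ^ 2 * (some x₁ y₁ h₁ + some x₂ y₂ h₂).sym2x (some x₁ y₁ h₁ - some x₂ y₂ h₂) i := by
  have hd : x₁ - x₂ ≠ 0 := sub_ne_zero.mpr hx
  have e₁ := (equation_iff ..).mp h₁.1
  have e₂ := (equation_iff ..).mp h₂.1
  rw [sub_eq_add_neg (some x₁ y₁ h₁), neg_some, add_of_X_ne hx, add_of_X_ne hx]
  simp only [sym2x_some_some]
  set p := W.toAffine.addX x₁ x₂ (W.toAffine.slope x₁ x₂ y₁ y₂) with hp
  set q := W.toAffine.addX x₁ x₂ (W.toAffine.slope x₁ x₂ y₁ (W.toAffine.negY x₂ y₂)) with hq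
  let f : F → F := fun x => x ^ 3 + W.a₂ * x ^ 2 + W.a₄ * x + W.a₆
  let S := f x₁ + f x₂ - (W.a₂ + x₁ + x₂) * (x₁ - x₂) ^ 2
  let t₁ := -(W.a₁ * x₁ + W.a₃)
  let t₂ := -(W.a₁ * x₂ + W.a₃)
  -- Here tᵢ - yᵢ is the y-coordinate of the negative point, and q arises from p by y₂ ↦ t₂ - y₂.
  -- Thus p + q and pq are invariant under both negations, and yᵢ(tᵢ - yᵢ) = -f(xᵢ) removes the yᵢ.
  have hp' : (x₁ - x₂) ^ 2 * p = S + (y₁ * (t₂ - y₂) + y₂ * (t₁ - y₁)) := by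
    rw [hp, slope_of_X_ne hx, addX]
    field_simp
    simp only [S, f, t₁, t₂]
    linear_combination e₁ + e₂
  have hq' : (x₁ - x₂) ^ 2 * q = S + (y₁ * y₂ + (t₂ - y₂) * (t₁ - y₁)) := by
    rw [hq, slope_of_X_ne hx, addX, negY]
    field_simp
    simp only [S, f, t₁, t₂]
    linear_combination e₁ + e₂
  have n₁ : y₁ * (t₁ - y₁) = -f x₁ := by
    simp only [f, t₁]
    linear_combination -e₁
  have n₂ : y₂ * (t₂ - y₂) = -f x₂ := by
    simp only [f, t₂]
    linear_combination -e₂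
  have hprod : (x₁ - x₂) ^ 4 * (p * q) = S ^ 2 + S * (t₁ * t₂) +
      (-f x₂) * (t₁ ^ 2 + 2 * f x₁) + (-f x₁) * (t₂ ^ 2 + 2 * f x₂) := by
    have h : ((x₁ - x₂) ^ 2 * p) * ((x₁ - x₂) ^ 2 * q) = _ := congrArg₂ (· * ·) hp' hq'
    rw [← neg_neg (f x₁), ← neg_neg (f x₂), ← n₁, ← n₂]
    linear_combination h
  have hd2 : (x₁ - x₂) ^ 2 ≠ 0 := pow_ne_zero _ hd
  fin_cases i
  · simp only [Fin.zero_eta, eval_addSubMap_zero]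
    apply mul_left_cancel₀ hd2
    simp only [Matrix.cons_val_zero, Matrix.cons_val_one, Matrix.cons_val]
    rw [show (x₁ - x₂) ^ 2 * ((x₁ - x₂) ^ 2 * (p * q)) = (x₁ - x₂) ^ 4 * (p * q) by ring, hprod]
    simp only [S, f, t₁, t₂, b₄, b₆, b₈]
    ring
  · simp only [Fin.mk_one, eval_addSubMap_one]
    simp only [Matrix.cons_val_zero, Matrix.cons_val_one, Matrix.cons_val]
    simp only [S, f, t₁, t₂] at hp' hq'
    simp only [b₂, b₄, b₆]
    linear_combination -hp' - hq'
  · simp only [Fin.reduceFinMk, eval_addSubMap_two]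
    simp only [Matrix.cons_val_zero, Matrix.cons_val_one, Matrix.cons_val]
    ring

theorem exists_eval_addSubMap_sym2x_self {x y : F} (h : W.toAffine.Nonsingular x y) :
    ∃ c : F, ∀ i, (addSubMap W i).eval ((some x y h).sym2x (some x y h)) =
      c * (some x y h + some x y h).sym2x 0 i := by
  have e := (equation_iff ..).mp h.1
  by_cases hy : y = W.toAffine.negY x y
  · rw [add_self_of_Y_eq hy]
    -- The scalar is the numerator of the duplication formula, whose denominator vanishes here.
    refine ⟨x ^ 4 - W.b₄ * x ^ 2 - 2 * W.b₆ * x - W.b₈, fun i => ?_⟩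
    rw [negY] at hy
    fin_cases i
    · simp [eval_addSubMap_zero]
      ring
    · simp [eval_addSubMap_one, b₂, b₄, b₆]
      linear_combination (-4) * e + (W.a₁ * x + W.a₃ + 2 * y) * hy
    · simp [eval_addSubMap_two]
      ring
  · rw [add_self_of_Y_ne hy]
    have hd : y - W.toAffine.negY x y ≠ 0 := sub_ne_zero.mpr hy
    have hD : y - W.toAffine.negY x y = 2 * y + W.a₁ * x + W.a₃ := by
      rw [negY]
      ring
    refine ⟨(y - W.toAffine.negY x y) ^ 2, fun i => ?_⟩
    rw [sym2x_some_some, sym2x_some_zero, slope_of_Y_ne rfl hy]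
    simp only [addX]
    generalize y - W.toAffine.negY x y = D at hD hd ⊢
    fin_cases i
    · simp only [Fin.zero_eta, eval_addSubMap_zero, Matrix.cons_val_zero, Matrix.cons_val_one,
        Matrix.cons_val]
      field_simp
      simp only [hD, b₄, b₆, b₈]
      linear_combination (W.a₁ ^ 2 + 4 * W.a₂ + 8 * x) * e
    · simp [eval_addSubMap_one, hD, b₂, b₄, b₆]
      linear_combination (-4) * e
    · simp [eval_addSubMap_two]
      ring

theorem exists_eval_addSubMap_sym2x (P Q : W.toAffine.Point) :
    ∃ c : F, ∀ i, (addSubMap W i).eval (P.sym2x Q) = c * (P + Q).sym2x (P - Q) i := by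
  rcases P with _ | ⟨x₁, y₁, h₁⟩
  · refine ⟨1, fun i => ?_⟩
    rw [← zero_def, zero_add, zero_sub, sym2x_neg_right]
    rcases Q with _ | ⟨x₂, y₂, h₂⟩
    · rw [← zero_def, sym2x_zero_zero]
      fin_cases i <;> simp [eval_addSubMap_zero, eval_addSubMap_one, eval_addSubMap_two]
    · rw [sym2x_zero_some, sym2x_some_some]
      fin_cases i <;> simp [eval_addSubMap_zero, eval_addSubMap_one, eval_addSubMap_two] <;> ring
  rcases Q with _ | ⟨x₂, y₂, h₂⟩
  · refine ⟨1, fun i => ?_⟩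
    rw [← zero_def, add_zero, sub_zero, sym2x_some_zero, sym2x_some_some]
    fin_cases i <;> simp [eval_addSubMap_zero, eval_addSubMap_one, eval_addSubMap_two] <;> ring
  by_cases hx : x₁ = x₂
  · obtain ⟨c, hc⟩ := exists_eval_addSubMap_sym2x_self W h₁
    refine ⟨c, ?_⟩
    rcases X_eq_iff.mp hx with h | h
    · rw [← h, sub_self]
      exact hc
    · rw [← neg_eq_iff_eq_neg] at h
      rw [← h, sym2x_neg_right, ← sub_eq_add_neg, sub_self, sub_neg_eq_add, sym2x_comm 0]
      exact hc
  · exact ⟨_, eval_addSubMap_sym2x_of_X_ne W h₁ h₂ hx⟩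


/-- Multiplication by `n` is given on `x`-coordinates by `(A : B)`, with `A` and `B` coprime of
maximal degree `n ^ 2`. -/
def IsXMultiple (n : ℕ) (A B : F[X]) : Prop :=
  IsCoprime A B ∧ IsMaxDegree A B (n ^ 2) ∧ ∀ x y (h : W.toAffine.Nonsingular x y),
    (n • some x y h).xRep 0 * B.eval x = (n • some x y h).xRep 1 * A.eval x

theorem isXMultiple_zero : IsXMultiple W 0 1 0 := by
  refine ⟨isCoprime_one_left, ⟨by simp, by simp, by simp⟩, fun x y h => ?_⟩
  rw [zero_smul]
  simp

theorem isXMultiple_one : IsXMultiple W 1 X 1 := by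
  refine ⟨isCoprime_one_right, ⟨by simp, by simp, by simp⟩, fun x y h => ?_⟩
  rw [one_smul]
  simp

/-- Apply `addSubMap` to (n+1)P and P: the result (T : S : D) is the symmetric product of x((n+2)P)
and x(nP). Dividing out the known factor (A₀ : B₀) leaves the pair for n + 2. -/
theorem IsXMultiple.add_two [IsAlgClosed F] [W.IsElliptic] {n : ℕ} {A B A₀ B₀ : F[X]}
    (h₁ : IsXMultiple W (n + 1) A B) (h₀ : IsXMultiple W n A₀ B₀) :
    ∃ A' B', IsXMultiple W (n + 2) A' B' := by
  obtain ⟨hAB, hd, hx⟩ := h₁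
  obtain ⟨hAB₀, hd₀, hx₀⟩ := h₀
  let T := C 1 * (A * X) * (A * X) - C W.b₄ * (A * X) * B - C W.b₆ * (A + B * X) * B -
    C W.b₈ * B * B
  let S := C 2 * (A + B * X) * (A * X) + C W.b₂ * (A * X) * B + C W.b₄ * (A + B * X) * B +
    C W.b₆ * B * B
  let D := C 1 * (A + B * X) * (A + B * X) - C 4 * (A * X) * B
  have hpt : ∀ x y (h : W.toAffine.Nonsingular x y), ∃ k ≠ 0,
      T.eval x = k * (((n + 2) • some x y h).xRep 0 * (n • some x y h).xRep 0) ∧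
      S.eval x = k * (((n + 2) • some x y h).xRep 0 * (n • some x y h).xRep 1 +
        ((n + 2) • some x y h).xRep 1 * (n • some x y h).xRep 0) ∧
      D.eval x = k * (((n + 2) • some x y h).xRep 1 * (n • some x y h).xRep 1) := by
    intro x y h
    obtain ⟨c, hc0, hcA, hcB⟩ := exists_eq_mul_xRep ((n + 1) • some x y h)
      (eval_ne_zero_or_of_isCoprime hAB x) (hx x y h)
    obtain ⟨e, he⟩ := exists_eval_addSubMap_sym2x W ((n + 1) • some x y h) (some x y h)
    rw [show (n + 1) • some x y h + some x y h = (n + 2) • some x y h by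
        rw [← succ_nsmul], show (n + 1) • some x y h - some x y h = n • some x y h by
        rw [succ_nsmul, add_sub_cancel_right]] at he
    have he0 : e ≠ 0 := by
      rintro rfl
      apply addSubMap_ne_zero W (sym2x_ne_zero ((n + 1) • some x y h) (some x y h))
      ext i
      rw [he, zero_mul]
      rfl
    refine ⟨c ^ 2 * e, mul_ne_zero (pow_ne_zero _ hc0) he0, ?_, ?_, ?_⟩
    · have := he 0
      simp only [eval_addSubMap_zero, sym2x, xRep_some, Matrix.cons_val_zero, Matrix.cons_val_one,
        Matrix.cons_val] at this
      simp only [T, eval_sub, eval_mul, eval_add, eval_X, eval_C, hcA, hcB]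
      linear_combination c ^ 2 * this
    · have := he 1
      simp only [eval_addSubMap_one, sym2x, xRep_some, Matrix.cons_val_zero, Matrix.cons_val_one,
        Matrix.cons_val] at this
      simp only [S, eval_mul, eval_add, eval_X, eval_C, hcA, hcB]
      linear_combination c ^ 2 * this
    · have := he 2
      simp only [eval_addSubMap_two, sym2x, xRep_some, Matrix.cons_val_zero, Matrix.cons_val_one,
        Matrix.cons_val] at this
      simp only [D, eval_sub, eval_mul, eval_add, eval_X, eval_C, hcA, hcB]
      linear_combination c ^ 2 * this
  have : Infinite F := IsAlgClosed.instInfinite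
  have hzero : T * B₀ ^ 2 - S * A₀ * B₀ + D * A₀ ^ 2 = 0 := by
    refine Polynomial.funext fun x => ?_
    obtain ⟨y, h, -⟩ := exists_eq_some W x
    obtain ⟨k, -, hT, hS, hD⟩ := hpt x y h
    obtain ⟨c, -, hcA, hcB⟩ := exists_eq_mul_xRep (n • some x y h)
      (eval_ne_zero_or_of_isCoprime hAB₀ x) (hx₀ x y h)
    simp only [eval_sub, eval_mul, eval_pow, eval_add, hT, hS, hD, hcA, hcB, eval_zero]
    ring
  obtain ⟨A', B', hT, hS, hD⟩ := exists_factor_of_isCoprime hAB₀ hzero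
  have hpt' : ∀ x y (h : W.toAffine.Nonsingular x y), ∃ c ≠ 0,
      A'.eval x = c * ((n + 2) • some x y h).xRep 0 ∧
      B'.eval x = c * ((n + 2) • some x y h).xRep 1 := by
    intro x y h
    obtain ⟨k, hk, hTx, hSx, hDx⟩ := hpt x y h
    obtain ⟨c, hc, hcA, hcB⟩ := exists_eq_mul_xRep (n • some x y h)
      (eval_ne_zero_or_of_isCoprime hAB₀ x) (hx₀ x y h)
    rw [hT, eval_mul, hcA] at hTx
    rw [hS, eval_add, eval_mul, eval_mul, hcA, hcB] at hSx
    rw [hD, eval_mul, hcB] at hDx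
    refine ⟨k / c, div_ne_zero hk hc, ?_⟩
    rw [div_mul_eq_mul_div, div_mul_eq_mul_div, eq_div_iff hc, eq_div_iff hc]
    generalize n • some x y h = Q at hTx hSx hDx
    rcases Q with _ | ⟨x', y', h'⟩
    · simp only [← zero_def, xRep_zero, Matrix.cons_val_zero, Matrix.cons_val_one,
        Matrix.cons_val_fin_one] at hTx hSx
      exact ⟨by linear_combination hTx, by linear_combination hSx⟩
    · simp only [xRep_some, Matrix.cons_val_zero, Matrix.cons_val_one,
        Matrix.cons_val_fin_one] at hTx hSx hDx
      exact ⟨by linear_combination hSx - x' * hDx, by linear_combination hDx⟩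
  have hne : ∀ x, A'.eval x ≠ 0 ∨ B'.eval x ≠ 0 := by
    intro x
    obtain ⟨y, h, -⟩ := exists_eq_some W x
    obtain ⟨c, hc, hcA, hcB⟩ := hpt' x y h
    rw [hcA, hcB]
    by_contra! h0
    apply xRep_ne_zero ((n + 2) • some x y h)
    ext i
    fin_cases i
    · simpa [hc] using h0.1
    · simpa [hc] using h0.2
  have hd' : IsMaxDegree A' B' (max A'.natDegree B'.natDegree) := by
    refine isMaxDegree_max ?_
    by_contra! h0
    simpa [h0.1, h0.2] using hne 0
  have hle := natDegree_mul_le_of_isMaxDegree hd₀ hd'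
  have hco := coeff_mul_of_isMaxDegree hd₀ hd'
  rw [← hT, ← hS, ← hD] at hle hco
  set m := (n + 1) ^ 2 with hm
  have hAX : (A * X).natDegree ≤ m + 1 := natDegree_mul_le_of_le hd.1 natDegree_X_le
  have hBX : (A + B * X).natDegree ≤ m + 1 :=
    natDegree_add_le_of_degree_le (hd.1.trans (Nat.le_succ m))
      (natDegree_mul_le_of_le hd.2.1 natDegree_X_le)
  have hB : B.natDegree ≤ m + 1 := hd.2.1.trans (Nat.le_succ m)
  have hc₀ : (A * X).coeff (m + 1) = A.coeff m := coeff_mul_X _ _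
  have hc₁ : (A + B * X).coeff (m + 1) = B.coeff m := by
    rw [coeff_add, coeff_mul_X, coeff_eq_zero_of_natDegree_lt (Nat.lt_succ_of_le hd.1), zero_add]
  have hc₂ : B.coeff (m + 1) = 0 := coeff_eq_zero_of_natDegree_lt (Nat.lt_succ_of_le hd.2.1)
  -- The coefficients of T, S, D in degree 2(m+1) are `addSubMap` at this vector, the limit as x
  -- tends to infinity. They do not all vanish, so the maximal degree is exactly 2(m+1) = n² +
  -- (n+2)².
  have htop : ![A.coeff m, B.coeff m, 0] ≠ 0 := by
    intro h0
    rcases hd.2.2 with h1 | h1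
    · exact h1 (congrFun h0 0)
    · exact h1 (congrFun h0 1)
  have p₀₀ := natDegree_mul_le_and_coeff_mul hAX hAX
  have p₀₂ := natDegree_mul_le_and_coeff_mul hAX hB
  have p₁₂ := natDegree_mul_le_and_coeff_mul hBX hB
  have p₂₂ := natDegree_mul_le_and_coeff_mul hB hB
  have p₁₀ := natDegree_mul_le_and_coeff_mul hBX hAX
  have p₁₁ := natDegree_mul_le_and_coeff_mul hBX hBX
  have hTd : T.natDegree ≤ (m + 1) + (m + 1) :=
    (natDegree_sub_le_of_le (natDegree_sub_le_of_le (natDegree_sub_le_of_le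
      (p₀₀ _).1 (p₀₂ _).1) (p₁₂ _).1) (p₂₂ _).1).trans (by simp)
  have hSd : S.natDegree ≤ (m + 1) + (m + 1) :=
    natDegree_add_le_of_degree_le (natDegree_add_le_of_degree_le (natDegree_add_le_of_degree_le
      (p₁₀ _).1 (p₀₂ _).1) (p₁₂ _).1) (p₂₂ _).1
  have hDd : D.natDegree ≤ (m + 1) + (m + 1) :=
    (natDegree_sub_le_of_le (p₁₁ _).1 (p₀₂ _).1).trans (by simp)
  have hTc : T.coeff ((m + 1) + (m + 1)) = (addSubMap W 0).eval ![A.coeff m, B.coeff m, 0] := by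
    simp only [T, coeff_sub, p₀₀, p₀₂, p₁₂, p₂₂, hc₀, hc₁, hc₂]
    simp [eval_addSubMap_zero, sq]
  have hSc : S.coeff ((m + 1) + (m + 1)) = (addSubMap W 1).eval ![A.coeff m, B.coeff m, 0] := by
    simp only [S, coeff_add, p₁₀, p₀₂, p₁₂, p₂₂, hc₀, hc₁, hc₂]
    simp [eval_addSubMap_one]
  have hDc : D.coeff ((m + 1) + (m + 1)) = (addSubMap W 2).eval ![A.coeff m, B.coeff m, 0] := by
    simp only [D, coeff_sub, p₁₁, p₀₂, hc₀, hc₁, hc₂]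
    simp [eval_addSubMap_two, sq]
  have hmax : max A'.natDegree B'.natDegree = (n + 2) ^ 2 := by
    have h1 : n ^ 2 + max A'.natDegree B'.natDegree ≤ (m + 1) + (m + 1) := by
      rcases hco with h2 | h2 | h2
      · exact (le_natDegree_of_ne_zero h2).trans hTd
      · exact (le_natDegree_of_ne_zero h2).trans hSd
      · exact (le_natDegree_of_ne_zero h2).trans hDd
    have h2 : (m + 1) + (m + 1) ≤ n ^ 2 + max A'.natDegree B'.natDegree := by
      by_contra! h3
      apply addSubMap_ne_zero W htop
      ext i
      fin_cases i
      · exact hTc.symm.trans (coeff_eq_zero_of_natDegree_lt (hle.1.trans_lt h3))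
      · exact hSc.symm.trans (coeff_eq_zero_of_natDegree_lt (hle.2.1.trans_lt h3))
      · exact hDc.symm.trans (coeff_eq_zero_of_natDegree_lt (hle.2.2.trans_lt h3))
    have h3 : n ^ 2 + (n + 2) ^ 2 = (m + 1) + (m + 1) := by rw [hm]; ring
    omega
  rw [hmax] at hd'
  refine ⟨A', B', isCoprime_of_eval_ne_zero_or hne, hd', fun x y h => ?_⟩
  obtain ⟨c, -, hcA, hcB⟩ := hpt' x y h
  rw [hcA, hcB]
  ring

theorem exists_isXMultiple [IsAlgClosed F] [W.IsElliptic] (n : ℕ) :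
    ∃ A B, IsXMultiple W n A B := by
  induction n using Nat.twoStepInduction with
  | zero => exact ⟨_, _, isXMultiple_zero W⟩
  | one => exact ⟨_, _, isXMultiple_one W⟩
  | more n h₀ h₁ =>
    obtain ⟨A₀, B₀, h₀⟩ := h₀
    obtain ⟨A, B, h₁⟩ := h₁
    exact h₁.add_two W h₀

theorem card_torsionBy_le [IsAlgClosed F] [W.IsElliptic] {n : ℕ} (hn : 0 < n) :
    Finite (AddSubgroup.torsionBy W.toAffine.Point (n : ℤ)) ∧
      Nat.card (AddSubgroup.torsionBy W.toAffine.Point (n : ℤ)) ≤ n ^ 2 := by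
  obtain ⟨A, B, hAB, hd, hx⟩ := exists_isXMultiple W n
  have hpos : 0 < max A.natDegree B.natDegree := hd.max_eq ▸ pow_pos hn 2
  have hB : B ≠ 0 := by
    rintro rfl
    have := natDegree_eq_zero_of_isUnit (isCoprime_zero_right.mp hAB)
    simp [this] at hpos
  have hf : HasXMap (nsmulAddMonoidHom n : W.toAffine.Point →+ W.toAffine.Point) A B := by
    refine ⟨{x | B.IsRoot x}, finite_setOfPred_isRoot hB, fun x y h hxB => ⟨hxB, ?_⟩⟩
    have h1 := hx x y h
    rw [nsmulAddMonoidHom_apply]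
    generalize n • some x y h = Q at h1
    rcases Q with _ | ⟨x', y', h'⟩
    · exact absurd (by simpa [← zero_def] using h1) hxB
    · exact ⟨x', y', h', rfl, by simpa using h1⟩
  have hker : (nsmulAddMonoidHom n : W.toAffine.Point →+ W.toAffine.Point).ker =
      AddSubgroup.torsionBy W.toAffine.Point (n : ℤ) := by
    ext P
    simp [AddMonoidHom.mem_ker]
  rw [← hker]
  exact ⟨finite_ker_of_hasXMap hf, hd.max_eq ▸ hf.card_ker_le hAB hpos⟩

end WeierstrassCurve.Affine.Point

/-! ### Function fields, and the x-coordinate map of an isogeny. -/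

namespace EllipticIsogeny

open WeierstrassCurve
open scoped Polynomial.Bivariate

section FunctionField

variable {k : Type u} [Field k] (E : WeierstrassCurve k)

/-- `polyFun` as a ring homomorphism. -/
noncomputable def polyFunHom : k[X][Y] →+* E.toAffine.FunctionField :=
  (algebraMap E.toAffine.CoordinateRing E.toAffine.FunctionField).comp
    (Affine.CoordinateRing.mk E.toAffine)

theorem polyFunHom_C (p : k[X]) :
    polyFunHom E (C p) = algebraMap k[X] E.toAffine.FunctionField p := by
  rw [IsScalarTower.algebraMap_apply k[X] E.toAffine.CoordinateRing E.toAffine.FunctionField]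
  rfl

theorem polyFunHom_C_C (a : k) :
    polyFunHom E (C (C a)) = algebraMap k E.toAffine.FunctionField a := by
  rw [polyFunHom_C, IsScalarTower.algebraMap_apply k k[X] E.toAffine.FunctionField]
  rfl

theorem polyFunHom_eq_iff {p q : k[X][Y]} :
    polyFunHom E p = polyFunHom E q ↔ E.toAffine.polynomial ∣ p - q := by
  rw [← AdjoinRoot.mk_eq_mk]
  exact (IsFractionRing.injective E.toAffine.CoordinateRing E.toAffine.FunctionField).eq_iff

theorem algebraMap_polynomial_injective :
    Function.Injective (algebraMap k[X] E.toAffine.FunctionField) := by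
  rw [IsScalarTower.algebraMap_eq k[X] E.toAffine.CoordinateRing E.toAffine.FunctionField]
  exact (IsFractionRing.injective E.toAffine.CoordinateRing E.toAffine.FunctionField).comp
    (FaithfulSMul.algebraMap_injective _ _)

theorem polyFunHom_equation :
    polyFunHom E Y ^ 2 + algebraMap k _ E.a₁ * polyFunHom E (C X) * polyFunHom E Y +
      algebraMap k _ E.a₃ * polyFunHom E Y =
    polyFunHom E (C X) ^ 3 + algebraMap k _ E.a₂ * polyFunHom E (C X) ^ 2 +
      algebraMap k _ E.a₄ * polyFunHom E (C X) + algebraMap k _ E.a₆ := by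
  simp only [← polyFunHom_C_C, ← map_mul, ← map_pow, ← map_add]
  rw [polyFunHom_eq_iff, Affine.polynomial]
  refine ⟨1, ?_⟩
  simp only [map_add, map_mul, map_pow]
  ring

/-- The coordinate ring is finite over k[x], so every nonzero denominator divides a nonzero
polynomial in x; numerators reduce to p + qy. -/
theorem exists_polyFunHom_eq (f : E.toAffine.FunctionField) :
    ∃ (p q s : k[X]), s ≠ 0 ∧ f = polyFunHom E (C p + C q * Y) / polyFunHom E (C s) := by
  obtain ⟨a, b, hb, rfl⟩ := IsFractionRing.div_surjective (A := E.toAffine.CoordinateRing) f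
  have : Module.Finite k[X] E.toAffine.CoordinateRing :=
    .of_basis (Affine.CoordinateRing.basis E.toAffine)
  obtain ⟨s, hs, b', hbb'⟩ :=
    (Algebra.IsAlgebraic.isAlgebraic (R := k[X]) b).exists_nonzero_dvd hb
  obtain ⟨p, q, hpq⟩ := Affine.CoordinateRing.exists_smul_basis_eq (a * b')
  refine ⟨p, q, s, hs, ?_⟩
  have hinj := IsFractionRing.injective E.toAffine.CoordinateRing E.toAffine.FunctionField
  have hb0 : algebraMap E.toAffine.CoordinateRing E.toAffine.FunctionField b ≠ 0 :=
    IsFractionRing.to_map_ne_zero_of_mem_nonZeroDivisors hb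
  have hs0 : polyFunHom E (C s) ≠ 0 := by
    rw [polyFunHom_C]
    exact (map_ne_zero_iff _ (algebraMap_polynomial_injective E)).mpr hs
  rw [div_eq_div_iff hb0 hs0]
  have h1 : polyFunHom E (C s) = algebraMap E.toAffine.CoordinateRing _ (b * b') := by
    rw [← hbb']
    rfl
  have h2 : polyFunHom E (C p + C q * Y) = algebraMap E.toAffine.CoordinateRing _ (a * b') := by
    rw [← hpq, Affine.CoordinateRing.smul, Affine.CoordinateRing.smul, mul_one, ← map_mul,
      ← map_add]
    rfl
  rw [h1, h2, map_mul, map_mul]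
  ring

/-- The inclusion of `k(x)` into the function field. -/
noncomputable def ratFuncHom : RatFunc k →ₐ[k] E.toAffine.FunctionField :=
  RatFunc.liftAlgHom (IsScalarTower.toAlgHom k k[X] E.toAffine.FunctionField)
    (nonZeroDivisors_le_comap_nonZeroDivisors_of_injective _ (algebraMap_polynomial_injective E))

theorem ratFuncHom_algebraMap (p : k[X]) :
    ratFuncHom E (algebraMap k[X] (RatFunc k) p) =
      algebraMap k[X] E.toAffine.FunctionField p := by
  have := RatFunc.liftAlgHom_apply_div (IsScalarTower.toAlgHom k k[X] E.toAffine.FunctionField)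
    (nonZeroDivisors_le_comap_nonZeroDivisors_of_injective _
      (algebraMap_polynomial_injective E)) p 1
  simpa [ratFuncHom] using this

theorem finrank_fieldRange_ratFuncHom :
    Module.finrank (ratFuncHom E).fieldRange E.toAffine.FunctionField = 2 := by
  let : Algebra (RatFunc k) E.toAffine.FunctionField := (ratFuncHom E).toRingHom.toAlgebra
  have : IsScalarTower k[X] (RatFunc k) E.toAffine.FunctionField :=
    .of_algebraMap_eq fun p => (ratFuncHom_algebraMap E p).symm
  have h1 : Module.finrank (RatFunc k) E.toAffine.FunctionField = 2 := by
    rw [IsFractionRing.finrank_eq k[X] (RatFunc k) E.toAffine.CoordinateRing,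
      Module.finrank_eq_card_basis (Affine.CoordinateRing.basis E.toAffine), Fintype.card_fin]
  rw [← h1]
  symm
  exact Algebra.finrank_eq_of_equiv_equiv
    (AlgEquiv.ofInjectiveField (ratFuncHom E)).toRingEquiv (RingEquiv.refl _) rfl

open IntermediateField in
-- The copy of k(r) in k(E) is ψ(k(x')). Computing the degree of k(E) over it through k(x) and
-- through ψ(k(E')) gives a factor 2 on both sides, which cancels.
theorem finrank_fieldRange_eq_max_natDegree {E' : WeierstrassCurve k}
    (ψ : E'.toAffine.FunctionField →ₐ[k] E.toAffine.FunctionField) {r : RatFunc k}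
    (hr : ψ (xFun E') = ratFuncHom E r) :
    Module.finrank ψ.fieldRange E.toAffine.FunctionField =
      max r.num.natDegree r.denom.natDegree := by
  have hx : ratFuncHom E' RatFunc.X = xFun E' := by
    rw [← RatFunc.algebraMap_X, ratFuncHom_algebraMap, ← polyFunHom_C]
    rfl
  have hM : (k⟮r⟯).map (ratFuncHom E) = (ratFuncHom E').fieldRange.map ψ := by
    rw [AlgHom.fieldRange_eq_map, ← RatFunc.adjoin_X, adjoin_map, adjoin_map, adjoin_map,
      Set.image_singleton, Set.image_singleton, Set.image_singleton, hx, hr]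
  have h1 := relfinrank_mul_finrank_top
    (map_mono (ratFuncHom E) (le_top (a := k⟮r⟯)))
  have h2 := relfinrank_mul_finrank_top
    (map_mono ψ (le_top (a := (ratFuncHom E').fieldRange)))
  rw [relfinrank_map_map, relfinrank_top_right, ← AlgHom.fieldRange_eq_map] at h1 h2
  rw [finrank_fieldRange_ratFuncHom, RatFunc.finrank_eq_max_natDegree, hM] at h1
  rw [finrank_fieldRange_ratFuncHom, ← h1] at h2
  omega

end FunctionField

instance isElliptic_baseChange {k : Type u} [Field k] (E : WeierstrassCurve k) [E.IsElliptic]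
    (A : Type u) [Field A] [Algebra k A] : (E.baseChange A).IsElliptic :=
  inferInstanceAs (E.map (algebraMap k A)).IsElliptic

section IsogenyPoints

variable {k : Type u} [Field k] {E E' : WeierstrassCurve k}

theorem aevalAeval_eq_of_polyFunHom_eq {x y : AlgebraicClosure k}
    (h : (E.baseChange (AlgebraicClosure k)).toAffine.Equation x y) {p q : k[X][Y]}
    (hpq : polyFunHom E p = polyFunHom E q) : aevalAeval x y p = aevalAeval x y q := by
  obtain ⟨g, hg⟩ := (polyFunHom_eq_iff E).mp hpq
  have h0 : aevalAeval x y E.toAffine.polynomial = 0 := by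
    have he := (Affine.equation_iff' ..).mp h
    change y ^ 2 + algebraMap k _ E.a₁ * x * y + algebraMap k _ E.a₃ * y -
      (x ^ 3 + algebraMap k _ E.a₂ * x ^ 2 + algebraMap k _ E.a₄ * x + algebraMap k _ E.a₆) = 0 at he
    simp only [Affine.polynomial, map_add, map_sub, map_mul, map_pow, aevalAeval_Y, aevalAeval_C,
      aeval_X, aeval_C]
    linear_combination he
  rw [← sub_eq_zero, ← map_sub, hg, map_mul, h0, zero_mul]

variable [E.IsElliptic] [E'.IsElliptic]

/-- The pullback preserves the Weierstrass equation of E', so the values form a point of E' and the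
defining equivalence of `Isogeny` applies. -/
theorem Isogeny.onPoints_some (φ : Isogeny E E') {a b c : k[X][Y]}
    (ha : φ.pullback (xFun E') = polyFunHom E a / polyFunHom E b)
    (hc : φ.pullback (yFun E') = polyFunHom E c / polyFunHom E b) {x y : AlgebraicClosure k}
    (h : (E.baseChange (AlgebraicClosure k)).toAffine.Nonsingular x y)
    (hb : aevalAeval x y b ≠ 0) :
    ∃ h', φ.onPoints (.some x y h) =
      .some (aevalAeval x y a / aevalAeval x y b) (aevalAeval x y c / aevalAeval x y b) h' := by
  have hb' : polyFunHom E b ≠ 0 := by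
    intro h0
    rw [← map_zero (polyFunHom E)] at h0
    apply hb
    rw [aevalAeval_eq_of_polyFunHom_eq h.1 h0, map_zero]
  have he := congrArg φ.pullback (polyFunHom_equation E')
  have hX : φ.pullback (polyFunHom E' (C X)) = polyFunHom E a / polyFunHom E b := ha
  have hY : φ.pullback (polyFunHom E' Y) = polyFunHom E c / polyFunHom E b := hc
  simp only [map_add, map_mul, map_pow, AlgHom.commutes, hX, hY] at he
  simp only [← polyFunHom_C_C] at he
  field_simp at he
  have he' : polyFunHom E (c ^ 2 * b + C (C E'.a₁) * a * c * b + C (C E'.a₃) * c * b ^ 2) =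
      polyFunHom E (a ^ 3 + C (C E'.a₂) * a ^ 2 * b + C (C E'.a₄) * a * b ^ 2 +
        C (C E'.a₆) * b ^ 3) := by
    simp only [map_add, map_mul, map_pow]
    linear_combination he
  have he'' := aevalAeval_eq_of_polyFunHom_eq h.1 he'
  simp only [map_add, map_mul, map_pow, aevalAeval_C, aeval_C] at he''
  have heq : (E'.baseChange (AlgebraicClosure k)).toAffine.Equation
      (aevalAeval x y a / aevalAeval x y b) (aevalAeval x y c / aevalAeval x y b) := by
    rw [Affine.equation_iff]
    change (aevalAeval x y c / aevalAeval x y b) ^ 2 +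
        algebraMap k _ E'.a₁ * (aevalAeval x y a / aevalAeval x y b) *
          (aevalAeval x y c / aevalAeval x y b) +
        algebraMap k _ E'.a₃ * (aevalAeval x y c / aevalAeval x y b) =
      (aevalAeval x y a / aevalAeval x y b) ^ 3 +
        algebraMap k _ E'.a₂ * (aevalAeval x y a / aevalAeval x y b) ^ 2 +
        algebraMap k _ E'.a₄ * (aevalAeval x y a / aevalAeval x y b) + algebraMap k _ E'.a₆
    field_simp
    linear_combination he''
  refine ⟨Affine.equation_iff_nonsingular.mp heq, ?_⟩
  rw [φ.onPoints_eq_some_iff]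
  exact ⟨a, b, c, hb, ha, hc, rfl, rfl⟩

theorem Isogeny.exists_ratFunc (φ : Isogeny E E') :
    ∃ r : RatFunc k, φ.pullback (xFun E') = ratFuncHom E r ∧
      Affine.Point.HasXMap φ.onPoints (r.num.map (algebraMap k (AlgebraicClosure k)))
        (r.denom.map (algebraMap k (AlgebraicClosure k))) := by
  obtain ⟨p, q, s, hs, hα⟩ := exists_polyFunHom_eq E (φ.pullback (xFun E'))
  obtain ⟨p', q', s', hs', hβ⟩ := exists_polyFunHom_eq E (φ.pullback (yFun E'))
  have hC : ∀ {t : k[X]}, t ≠ 0 → polyFunHom E (C t) ≠ 0 := fun ht => by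
    rw [polyFunHom_C]
    exact (map_ne_zero_iff _ (algebraMap_polynomial_injective E)).mpr ht
  have hs0 := hC hs
  have hs0' := hC hs'
  have ha : φ.pullback (xFun E') =
      polyFunHom E ((C p + C q * Y) * C s') / polyFunHom E (C (s * s')) := by
    rw [hα, C_mul, map_mul, map_mul, mul_div_mul_right _ _ hs0']
  have hc : φ.pullback (yFun E') =
      polyFunHom E ((C p' + C q' * Y) * C s) / polyFunHom E (C (s * s')) := by
    rw [hβ, mul_comm s s', C_mul, map_mul, map_mul, mul_div_mul_right _ _ hs0]
  have hval : ∀ x y h, aeval x (s * s') ≠ 0 → ∃ x' y' h',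
      φ.onPoints (.some x y h) = .some x' y' h' ∧ x' * aeval x s = aeval x p + aeval x q * y := by
    intro x y h hx
    obtain ⟨h', hφ⟩ := φ.onPoints_some ha hc h (by rwa [aevalAeval_C])
    refine ⟨_, _, h', hφ, ?_⟩
    rw [map_mul] at hx
    simp only [map_mul, map_add, aevalAeval_C, aevalAeval_Y]
    field_simp [left_ne_zero_of_mul hx, right_ne_zero_of_mul hx]
  have hroots : ∀ {t : k[X]}, t ≠ 0 → {x : AlgebraicClosure k | aeval x t = 0}.Finite := by
    intro t ht
    have := finite_setOfPred_isRoot (p := t.map (algebraMap k (AlgebraicClosure k)))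
      ((Polynomial.map_ne_zero_iff (algebraMap k _).injective).mpr ht)
    simpa only [IsRoot, eval_map_algebraMap] using this
  -- The images of P and -P share their x-coordinate. At a general x this forces q(x)y to be
  -- unchanged under negation, impossible if q(x) ≠ 0 and P ≠ -P.
  have hq : q = 0 := by
    by_contra hq
    obtain ⟨T, hT, hTy⟩ :=
      Affine.Point.finite_xRep_of_neg_eq_self (E.baseChange (AlgebraicClosure k))
    have : Infinite (AlgebraicClosure k) := IsAlgClosed.instInfinite
    obtain ⟨x, hx⟩ := ((hT.union (hroots hq)).union (hroots (mul_ne_zero hs hs'))).exists_notMem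
    simp only [Set.mem_union, not_or] at hx
    obtain ⟨⟨hxT, hxq⟩, hxs⟩ := hx
    obtain ⟨y, h, -⟩ := Affine.Point.exists_eq_some (E.baseChange (AlgebraicClosure k)) x
    obtain ⟨x₁, y₁, h₁, e₁, v₁⟩ := hval x y h hxs
    obtain ⟨x₂, y₂, h₂, e₂, v₂⟩ := hval x _ ((Affine.nonsingular_neg ..).mpr h) hxs
    rw [← Affine.Point.neg_some h, map_neg, e₁, Affine.Point.neg_some, Affine.Point.some.injEq] at e₂
    rw [← e₂.1, v₁, add_right_inj] at v₂
    exact hxT (hTy x y h (mul_left_cancel₀ hxq v₂).symm)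
  subst hq
  refine ⟨algebraMap _ _ p / algebraMap _ _ s, ?_, ?_⟩
  · rw [hα, map_div₀, ratFuncHom_algebraMap, ratFuncHom_algebraMap, polyFunHom_C, C_0, zero_mul,
      add_zero, polyFunHom_C]
  · set r : RatFunc k := algebraMap _ _ p / algebraMap _ _ s with hr
    have hrs : r.num * s = p * r.denom := by
      have h1 := RatFunc.num_div_denom r
      rw [hr, ← hr] at h1
      rw [div_eq_div_iff (RatFunc.algebraMap_ne_zero r.denom_ne_zero)
        (RatFunc.algebraMap_ne_zero hs), ← map_mul, ← map_mul] at h1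
      exact RatFunc.algebraMap_injective k h1
    refine ⟨{x | aeval x (s * s') = 0} ∪ {x | aeval x r.denom = 0},
      (hroots (mul_ne_zero hs hs')).union (hroots r.denom_ne_zero), fun x y h hx => ?_⟩
    simp only [Set.mem_union, not_or] at hx
    obtain ⟨x', y', h', h1, h2⟩ := hval x y h hx.1
    rw [eval_map_algebraMap, eval_map_algebraMap]
    refine ⟨hx.2, x', y', h', h1, ?_⟩
    have h3 : aeval x s ≠ 0 := fun h0 => hx.1 (by
      change aeval x (s * s') = 0
      rw [map_mul, h0, zero_mul])
    have h4 := congrArg (aeval x) hrs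
    rw [map_mul, map_mul] at h4
    apply mul_right_cancel₀ h3
    rw [map_zero, zero_mul, add_zero] at h2
    linear_combination aeval x r.denom * h2 - h4

theorem Isogeny.degree_eq (φ : Isogeny E E') {r : RatFunc k}
    (hr : φ.pullback (xFun E') = ratFuncHom E r) :
    φ.degree = max r.num.natDegree r.denom.natDegree :=
  finrank_fieldRange_eq_max_natDegree E φ.pullback hr

theorem Isogeny.surjective_onPoints (φ : Isogeny E E') (hφ : φ.degree ≠ 0) :
    Function.Surjective φ.onPoints := by
  obtain ⟨r, hr, hf⟩ := φ.exists_ratFunc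
  have hcop := r.isCoprime_num_denom.map (mapRingHom (algebraMap k (AlgebraicClosure k)))
  have hd := φ.degree_eq hr
  rw [← natDegree_map (p := r.num) (algebraMap k (AlgebraicClosure k)),
    ← natDegree_map (p := r.denom) (algebraMap k (AlgebraicClosure k))] at hd
  exact hf.surjective hcop (Nat.pos_of_ne_zero (hd ▸ hφ))

theorem Isogeny.card_ker_onPoints (φ : Isogeny E E') (hφ : (φ.degree : k) ≠ 0) :
    Nat.card φ.onPoints.ker = φ.degree := by
  obtain ⟨r, hr, hf⟩ := φ.exists_ratFunc
  have hcop := r.isCoprime_num_denom.map (mapRingHom (algebraMap k (AlgebraicClosure k)))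
  have hd := φ.degree_eq hr
  rw [← natDegree_map (p := r.num) (algebraMap k (AlgebraicClosure k)),
    ← natDegree_map (p := r.denom) (algebraMap k (AlgebraicClosure k))] at hd
  have hpos : 0 < φ.degree := Nat.pos_of_ne_zero fun h0 => hφ (by rw [h0, Nat.cast_zero])
  have hcast : (φ.degree : AlgebraicClosure k) ≠ 0 := by
    rw [← map_natCast (algebraMap k (AlgebraicClosure k))]
    exact (_root_.map_ne_zero _).mpr hφ
  rw [hd] at hpos hcast
  exact (hf.card_ker_eq hcop hpos hcast).trans hd.symm

end IsogenyPoints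

/-! ### Isogeny chains and the theorem. -/

section Chain

variable {k : Type u} [Field k] {ℓ n : ℕ} (c : IsogenyChain k ℓ n)

theorem IsogenyChain.surjective_and_card_ker (hℓk : (ℓ : k) ≠ 0) (i : ℕ) (hi : i < n) :
    Function.Surjective (c.isog i hi).onPoints ∧ Nat.card (c.isog i hi).onPoints.ker = ℓ := by
  have hd := c.degree_isog i hi
  have hd0 : ((c.isog i hi).degree : k) ≠ 0 := by rwa [hd]
  exact ⟨(c.isog i hi).surjective_onPoints fun h0 => hd0 (by rw [h0, Nat.cast_zero]),
    ((c.isog i hi).card_ker_onPoints hd0).trans hd⟩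

theorem IsogenyChain.compositeTo_surjective (hℓk : (ℓ : k) ≠ 0) (m : ℕ) (hm : m ≤ n) :
    Function.Surjective (c.compositeTo m hm) := by
  induction m with
  | zero => exact Function.surjective_id
  | succ m ih => exact (c.surjective_and_card_ker hℓk m hm).1.comp (ih (by omega))

theorem IsogenyChain.card_ker_compositeTo (hℓk : (ℓ : k) ≠ 0) (m : ℕ) (hm : m ≤ n) :
    Nat.card (c.compositeTo m hm).ker = ℓ ^ m := by
  induction m with
  | zero =>
    rw [pow_zero, AddSubgroup.card_eq_one, AddMonoidHom.ker_eq_bot_iff]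
    exact Function.injective_id
  | succ m ih =>
    rw [compositeTo, AddMonoidHom.card_ker_comp (c.compositeTo_surjective hℓk m (by omega)),
      (c.surjective_and_card_ker hℓk m hm).2, ih (by omega), pow_succ']

theorem IsogenyChain.ker_compositeTo_mono {m m' : ℕ} (h : m ≤ m') (hm' : m' ≤ n) :
    (c.compositeTo m (h.trans hm')).ker ≤ (c.compositeTo m' hm').ker := by
  induction m', h using Nat.le_induction with
  | base => exact le_rfl
  | succ m' h ih =>
    refine (ih (by omega)).trans fun P hP => ?_
    rw [AddMonoidHom.mem_ker] at hP ⊢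
    rw [compositeTo, AddMonoidHom.comp_apply, hP, map_zero]

theorem IsogenyChain.isAddCyclic_ker_compositeTo (hℓ : ℓ.Prime) (hℓk : (ℓ : k) ≠ 0)
    (hc : c.WithoutBacktracking) (m : ℕ) (hm : m ≤ n) :
    IsAddCyclic (c.compositeTo m hm).ker := by
  induction m using Nat.twoStepInduction with
  | zero =>
    have : Subsingleton (c.compositeTo 0 hm).ker :=
      (Nat.card_eq_one_iff_unique.mp (by rw [c.card_ker_compositeTo hℓk, pow_zero])).1
    infer_instance
  | one =>
    have : Fact ℓ.Prime := ⟨hℓ⟩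
    exact isAddCyclic_of_prime_card (p := ℓ) (by rw [c.card_ker_compositeTo hℓk, pow_one])
  | more m _ ih =>
    obtain ⟨hs, hk⟩ := c.surjective_and_card_ker hℓk m (by omega)
    obtain ⟨hs', hk'⟩ := c.surjective_and_card_ker hℓk (m + 1) hm
    have hker : Nat.card ((c.isog (m + 1) hm).onPoints.comp (c.isog m (by omega)).onPoints).ker =
        ℓ ^ 2 := by
      rw [AddMonoidHom.card_ker_comp hs, hk, hk', sq]
    obtain ⟨hfin, hle⟩ := WeierstrassCurve.Affine.Point.card_torsionBy_le
      ((c.curve ⟨m, by omega⟩).baseChange (AlgebraicClosure k)) hℓ.pos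
    -- The kernel has ℓ² elements and the ℓ-torsion at most ℓ², so containment would be equality,
    -- that is, backtracking.
    have hnot : ¬ ((c.isog (m + 1) hm).onPoints.comp (c.isog m (by omega)).onPoints).ker ≤
        AddSubgroup.torsionBy (GeomPoint (c.curve ⟨m, by omega⟩)) (ℓ : ℤ) := fun h =>
      hc m hm (SetLike.coe_injective (Set.eq_of_subset_of_ncard_le h
        (by simpa only [← Nat.card_coe_set_eq, SetLike.coe_sort_coe, hker] using hle) hfin))
    obtain ⟨w, hw, hwt⟩ := SetLike.not_le_iff_exists.mp hnot
    refine isAddCyclic_ker_comp_of_isAddCyclic hℓ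
      (c.compositeTo_surjective hℓk m (by omega)) hs hk hk'
      (c.card_ker_compositeTo hℓk (m + 1) (by omega)) (ih (by omega)) hw fun h0 => hwt ?_
    simpa using h0

end Chain

end EllipticIsogeny

theorem mainTheorem7 {k : Type u} [Field k] (ℓ : ℕ) (hℓ : ℓ.Prime) (hℓk : (ℓ : k) ≠ 0) (n : ℕ)
    (c : EllipticIsogeny.IsogenyChain k ℓ n) :
    IsAddCyclic c.composite.ker ↔ c.WithoutBacktracking := by
  refine ⟨fun hcyc i hi htors => ?_, fun hc => c.isAddCyclic_ker_compositeTo hℓ hℓk hc n le_rfl⟩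
  obtain ⟨hs, hk⟩ := c.surjective_and_card_ker hℓk i (by omega)
  obtain ⟨-, hk'⟩ := c.surjective_and_card_ker hℓk (i + 1) hi
  refine not_isAddCyclic_ker_comp hℓ (c.compositeTo_surjective hℓk i (by omega)) ?_ htors
    (c.ker_compositeTo_mono (m := i + 2) hi le_rfl) hcyc
  rw [AddMonoidHom.card_ker_comp hs, hk, hk', sq]
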